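/- Let $N\ge 2$, and let $\rho_1,\dots,\rho_N$ be qubit states (density operators on $\mathbb{C}^2$) with Bloch vectors $v_i\in\mathbb{R}^3$, so $\rho_i=\frac12(I+v_i\cdot\vec\sigma)$, where $\vec\sigma$ is the vector of Pauli matrices. Let $q_i\ge 0$, $\sum_i q_i=1$, be their prior probabilities, numbered so that $q_1=\max_i q_i$. A measurement is a family of operators $M_i\ge 0$ with $\sum_i M_i=I$. The guessing probability is $p_{\rm guess}=\max_{\{M_i\}_{i=1}^N}\sum_i q_i\operatorname{tr}[\rho_iM_i]$. The ensemble is said to be optimized with fewer than $N$ states if for some $\chi\subsetneq\{1,\dots,N\}$ there is a measurement $\{M_i\}_{i\in\chi}$ with $\sum_{i\in\chi}q_i\operatorname{tr}[\rho_iM_i]=p_{\rm guess}$. Complementary states are numbers $r_i\ge0$ and density operators $\tilde\rho_i$ such that $q_i\rho_i+r_i\tilde\rho_i=K$ does not depend on $i$ and $K$ has the least trace among all operators satisfying $K\ge q_i\rho_i$ for all $i$. Put $s_i=q_iv_i-q_1v_1$ and $e_i=q_1-q_i$, and assume that the affine hull of $\{s_1,\dots,s_N\}$ has dimension $D=N-1$.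 For $2\le i\le N$ let $C_i=\{c\in\mathbb{R}^3:\|c-s_i\|-\|c\|=e_i\}$. Let $\Omega$ be the relative interior of the simplex $\operatorname{conv}\{s_1,\dots,s_N\}$, and $\Lambda$ the relative interior of the convex cone with apex $0$ and base $\operatorname{conv}\{s_2,\dots,s_N\}$. Then $\bigcap_{i=2}^N C_i\cap\Lambda$ has at most one point; denote it by $\tilde c$ if it exists. The ensemble is not optimized with fewer than $N$ states if and only if $\tilde c$ exists and $\tilde c\in\Omega$. In that case the minimum-error measurement is unique, and $p_{\rm guess}=q_1+\|\tilde c\|$. Moreover, there are unique numbers $t_i>0$ with $\sum_i t_i=1$ and $\sum_i t_is_i=\tilde c$, and the optimal measurement is $$M_i=p_i(I+u_i\cdot\vec\sigma),\qquad p_i=\frac{t_i\|s_i-\tilde c\|}{\sum_{j=1}^N t_j\|s_j-\tilde c\|},\qquad u_i=\frac{s_i-\tilde c}{\|s_i-\tilde c\|}.$$ The complementary states are unique and given by $$r_i=\|s_i-\tilde c\|,\qquad \tilde\rho_i=\tfrac12(I+w_i\cdot\vec\sigma),\qquad w_i=\frac{\tilde c-s_i}{\|s_i-\tilde c\|},$$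 and they satisfy $r_i\operatorname{tr}[\tilde\rho_iM_i]=0$ for all $i$. -/

import Mathlib

noncomputable section

namespace QubitMD

open scoped ComplexOrder

/-- Operators on a qubit. -/
abbrev Op : Type := Matrix (Fin 2) (Fin 2) ℂ

/-- The space of Bloch vectors, with its Euclidean norm. -/
abbrev Vec : Type := EuclideanSpace ℝ (Fin 3)

/-- The Pauli matrices. -/
def sigmaX : Op := !![0, 1; 1, 0]
def sigmaY : Op := !![0, -Complex.I; Complex.I, 0]
def sigmaZ : Op := !![1, 0; 0, -1]

/-- The operator `v · σ`. -/
def pauliDot (v : Vec) : Op := v 0 • sigmaX + v 1 • sigmaY + v 2 • sigmaZ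

/-- The operator `(1/2) (I + v · σ)`, which has trace one and Bloch vector `v`. -/
def blochState (v : Vec) : Op := (1 / 2 : ℝ) • (1 + pauliDot v)

/-- Density operators (qubit states). -/
def IsDensity (A : Op) : Prop := A.PosSemidef ∧ A.trace = 1

section Discrimination

variable {ι : Type*} [Fintype ι]

/-- A measurement with outcomes `ι`: nonnegative operators that sum to the identity. -/
def IsPOVM (M : ι → Op) : Prop := (∀ i, (M i).PosSemidef) ∧ ∑ i, M i = 1

/-- The average probability `∑ i, q i * tr (ρ i * M i)` of a correct guess. -/
def successProb (q : ι → ℝ) (ρ M : ι → Op) : ℝ := ∑ i, q i * ((ρ i * M i).trace).re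

/-- The guessing probability. -/
def guessProb (q : ι → ℝ) (ρ : ι → Op) : ℝ :=
  sSup {x | ∃ M : ι → Op, IsPOVM M ∧ x = successProb q ρ M}

/-- `M` is a minimum-error measurement for the ensemble. -/
def IsOptimal (q : ι → ℝ) (ρ M : ι → Op) : Prop :=
  IsPOVM M ∧ ∀ M' : ι → Op, IsPOVM M' → successProb q ρ M' ≤ successProb q ρ M

/-- The ensemble is optimally discriminated with fewer outcomes than there are states: some
measurement whose outcomes are indexed by a subset `χ` of the states, of smaller cardinality,
reaches the guessing probability of the whole ensemble. -/
def OptimizedWithFewer (q : ι → ℝ) (ρ : ι → Op) : Prop :=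
  ∃ χ : Finset ι, χ.card < Fintype.card ι ∧ ∃ M : χ → Op, IsPOVM M ∧
    ∀ M' : ι → Op, IsPOVM M' →
      successProb q ρ M' ≤ successProb (fun i : χ => q i) (fun i : χ => ρ i) M

/-- Feasibility for the dual problem: `K ≥ q i • ρ i` for all `i`. -/
def IsDualFeasible (q : ι → ℝ) (ρ : ι → Op) (K : Op) : Prop :=
  ∀ i, (K - q i • ρ i).PosSemidef

/-- `K` has the least trace among the dual feasible operators. -/
def IsDualOptimal (q : ι → ℝ) (ρ : ι → Op) (K : Op) : Prop :=
  IsDualFeasible q ρ K ∧ ∀ K' : Op, IsDualFeasible q ρ K' → K.trace.re ≤ K'.trace.re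

/-- `r, τ` are complementary states of the ensemble: nonnegative weights and density operators
such that `q i • ρ i + r i • τ i` is, for all `i`, one and the same optimal operator of the dual
problem. -/
def IsComplementary (q : ι → ℝ) (ρ : ι → Op) (r : ι → ℝ) (τ : ι → Op) : Prop :=
  (∀ i, 0 ≤ r i) ∧ (∀ i, IsDensity (τ i)) ∧
    ∃ K : Op, (∀ i, K = q i • ρ i + r i • τ i) ∧ IsDualOptimal q ρ K

end Discrimination

section Geometry

variable {N : ℕ} [NeZero N]

/-- The points `s i = q i v i - q 1 v 1` (the first index is `0 : Fin N`). -/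
def sPoint (q : Fin N → ℝ) (v : Fin N → Vec) (i : Fin N) : Vec := q i • v i - q 0 • v 0

/-- The numbers `e i = q 1 - q i`. -/
def eGap (q : Fin N → ℝ) (i : Fin N) : ℝ := q 0 - q i

/-- The dimension of the affine hull of a set. -/
def affineDim (S : Set Vec) : ℕ := Module.finrank ℝ (affineSpan ℝ S).direction

/-- The hyperboloid (sheet) `C i`. -/
def hyperboloid (q : Fin N → ℝ) (v : Fin N → Vec) (i : Fin N) : Set Vec :=
  {c | ‖c - sPoint q v i‖ - ‖c‖ = eGap q i}

/-- `Ω`, the relative interior of the convex hull of all the points `s i`. -/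
def Omega (q : Fin N → ℝ) (v : Fin N → Vec) : Set Vec :=
  intrinsicInterior ℝ (convexHull ℝ (Set.range (sPoint q v)))

/-- `Λ`, the relative interior of the convex cone with apex `0` and base the convex hull of the
points `s i`, where `i` is not the first index. -/
def Lambda (q : Fin N → ℝ) (v : Fin N → Vec) : Set Vec :=
  intrinsicInterior ℝ
    {x | ∃ a : ℝ, 0 ≤ a ∧ ∃ y ∈ convexHull ℝ (sPoint q v '' {i | i ≠ 0}), x = a • y}

/-- `c` is an intersection point of the hyperboloids `C i` (`i` not the first index) in `Λ`. -/
def IsIntersectionPoint (q : Fin N → ℝ) (v : Fin N → Vec) (c : Vec) : Prop :=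
  (∀ i, i ≠ 0 → c ∈ hyperboloid q v i) ∧ c ∈ Lambda q v

/-- `t` is a system of positive barycentric coordinates of `c` with respect to the points `s i`. -/
def IsBarycentric (q : Fin N → ℝ) (v : Fin N → Vec) (c : Vec) (t : Fin N → ℝ) : Prop :=
  (∀ i, 0 < t i) ∧ ∑ i, t i = 1 ∧ ∑ i, t i • sPoint q v i = c

/-- The weights `r i = ‖s i - c‖`. -/
def rOf (q : Fin N → ℝ) (v : Fin N → Vec) (c : Vec) (i : Fin N) : ℝ := ‖sPoint q v i - c‖

/-- The unit vectors `u i = (s i - c) / ‖s i - c‖`. -/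
def uOf (q : Fin N → ℝ) (v : Fin N → Vec) (c : Vec) (i : Fin N) : Vec :=
  ‖sPoint q v i - c‖⁻¹ • (sPoint q v i - c)

/-- The unit vectors `w i = (c - s i) / ‖s i - c‖`. -/
def wOf (q : Fin N → ℝ) (v : Fin N → Vec) (c : Vec) (i : Fin N) : Vec :=
  ‖sPoint q v i - c‖⁻¹ • (c - sPoint q v i)

/-- The numbers `p i = t i ‖s i - c‖ / ∑ j, t j ‖s j - c‖`. -/
def pOf (q : Fin N → ℝ) (v : Fin N → Vec) (c : Vec) (t : Fin N → ℝ) (i : Fin N) : ℝ :=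
  t i * ‖sPoint q v i - c‖ / ∑ j, t j * ‖sPoint q v j - c‖

/-- The operators `M i = p i (I + u i · σ)`. -/
def povmOf (q : Fin N → ℝ) (v : Fin N → Vec) (c : Vec) (t : Fin N → ℝ) (i : Fin N) : Op :=
  pOf q v c t i • (1 + pauliDot (uOf q v c i))

/-- The operators `(1/2) (I + w i · σ)`. -/
def complOf (q : Fin N → ℝ) (v : Fin N → Vec) (c : Vec) (i : Fin N) : Op :=
  blochState (wOf q v c i)

end Geometry

end QubitMD

end

open QubitMD

/-! Every Hermitian operator on a qubit is `pauliOp a x`, that is `a I + x · σ`, and it is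
nonnegative exactly when `‖x‖ ≤ a`. A measurement thus becomes a family `(p i, y i)` with `‖y i‖ ≤ p
i`, `∑ p i = 1`, `∑ y i = 0`. A dual operator becomes a pair `(k, c)` subject to `q i + ‖s i - c‖ ≤
k` for all `i`: the dual problem asks for the smallest weighted ball around the points `s i`.

At a minimizer, `c` is a convex combination of the active points, those with equality
(`exists_minimax_convexCombination`). Its weights `t` define a measurement reaching `k`
(`successProb_povmOf`), unless all points with positive weight equal `c`; constant guessing is then
optimal. If no optimal measurement has a zero element, every `t i` is positive, so every constraint
is active: `c` lies on all the hyperboloids and in `Ω`.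

Conversely, let `c ∈ Ω` lie on all the hyperboloids. Weak duality (`successProb_le`) makes `povmOf`
optimal with value `k = q 0 + ‖c‖`. Any other optimal measurement attains equality in
Cauchy–Schwarz, so `y i` is parallel to `s i - c`, and affine independence determines the weights
(`eq_povmOf_of_le_successProb`). All its elements are nonzero, so no outcome can be dropped. The
same geometry determines the dual operator `K`, hence the complementary states as the normalized
differences `K - q i ρ i`. -/

noncomputable section

namespace QubitMD

open scoped ComplexOrder

/-! ### Bloch coordinates of Hermitian operators -/

/-- The operator `a I + x · σ`. -/
def pauliOp (a : ℝ) (x : Vec) : Op := a • (1 : Op) + pauliDot x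

theorem pauliDot_eq (x : Vec) :
    pauliDot x = !![(x 2 : ℂ), x 0 - Complex.I * x 1; x 0 + Complex.I * x 1, -x 2] := by
  ext i j
  fin_cases i <;> fin_cases j <;>
    simp [pauliDot, sigmaX, sigmaY, sigmaZ, mul_comm] <;> ring

theorem pauliOp_eq (a : ℝ) (x : Vec) :
    pauliOp a x = !![(a + x 2 : ℂ), x 0 - Complex.I * x 1; x 0 + Complex.I * x 1, a - x 2] := by
  rw [pauliOp, pauliDot_eq]
  ext i j
  fin_cases i <;> fin_cases j <;> simp <;> ring

theorem pauliDot_smul (a : ℝ) (x : Vec) : pauliDot (a • x) = a • pauliDot x := by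
  simp [pauliDot, smul_smul]

theorem pauliDot_add (x y : Vec) : pauliDot (x + y) = pauliDot x + pauliDot y := by
  simp only [pauliDot, PiLp.add_apply, add_smul]; abel

theorem pauliOp_add (a b : ℝ) (x y : Vec) :
    pauliOp a x + pauliOp b y = pauliOp (a + b) (x + y) := by
  simp only [pauliOp, pauliDot_add, add_smul]; abel

theorem pauliOp_smul (a b : ℝ) (x : Vec) : b • pauliOp a x = pauliOp (b * a) (b • x) := by
  simp only [pauliOp, pauliDot_smul, smul_add, smul_smul]

theorem pauliOp_sub (a b : ℝ) (x y : Vec) :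
    pauliOp a x - pauliOp b y = pauliOp (a - b) (x - y) := by
  rw [sub_eq_iff_eq_add, pauliOp_add]; simp

theorem pauliOp_zero : pauliOp 0 0 = 0 := by simp [pauliOp, pauliDot]

theorem pauliOp_one : pauliOp 1 0 = 1 := by simp [pauliOp, pauliDot]

theorem pauliOp_sum {ι : Type*} (s : Finset ι) (a : ι → ℝ) (x : ι → Vec) :
    ∑ i ∈ s, pauliOp (a i) (x i) = pauliOp (∑ i ∈ s, a i) (∑ i ∈ s, x i) := by
  classical
  induction s using Finset.induction_on with
  | empty => simp [pauliOp_zero]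
  | insert i s hi ih => simp [Finset.sum_insert hi, ih, pauliOp_add]

theorem blochState_eq (v : Vec) : blochState v = pauliOp (1 / 2) ((1 / 2 : ℝ) • v) := by
  simp only [blochState, pauliOp, pauliDot_smul, smul_add]

theorem inner_eq (x y : Vec) : inner ℝ x y = x 0 * y 0 + x 1 * y 1 + x 2 * y 2 := by
  simp [PiLp.inner_apply, Fin.sum_univ_three, mul_comm]

theorem trace_pauliOp (a : ℝ) (x : Vec) : (pauliOp a x).trace = ((2 * a : ℝ) : ℂ) := by
  rw [pauliOp_eq, Matrix.trace_fin_two]; simp; ring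

theorem trace_pauliOp_mul (a b : ℝ) (x y : Vec) :
    (pauliOp a x * pauliOp b y).trace = ((2 * (a * b + inner ℝ x y) : ℝ) : ℂ) := by
  rw [pauliOp_eq, pauliOp_eq, Matrix.trace_fin_two, inner_eq]
  simp [Matrix.mul_apply, Fin.sum_univ_two]
  linear_combination (-2 * (x 1 : ℂ) * y 1) * Complex.I_sq

theorem isHermitian_pauliOp (a : ℝ) (x : Vec) : (pauliOp a x).IsHermitian := by
  rw [pauliOp_eq]
  ext i j
  fin_cases i <;> fin_cases j <;> simp [Matrix.conjTranspose_apply] <;> ring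

theorem exists_pauliOp {A : Op} (hA : A.IsHermitian) : ∃ a x, A = pauliOp a x := by
  have h00 := congrArg Complex.im (hA.apply 0 0)
  have h11 := congrArg Complex.im (hA.apply 1 1)
  have h01r := congrArg Complex.re (hA.apply 0 1)
  have h01i := congrArg Complex.im (hA.apply 0 1)
  simp at h00 h11 h01r h01i
  refine ⟨((A 0 0).re + (A 1 1).re) / 2,
    !₂[(A 0 1).re, -(A 0 1).im, ((A 0 0).re - (A 1 1).re) / 2], ?_⟩
  rw [pauliOp_eq]
  ext i j
  fin_cases i <;> fin_cases j <;> apply Complex.ext <;> simp <;> linarith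

theorem pauliOp_inj {a b : ℝ} {x y : Vec} : pauliOp a x = pauliOp b y ↔ a = b ∧ x = y := by
  refine ⟨fun h => ?_, fun h => by rw [h.1, h.2]⟩
  rw [pauliOp_eq, pauliOp_eq] at h
  have h00 := congrArg Complex.re (congrFun (congrFun h 0) 0)
  have h11 := congrArg Complex.re (congrFun (congrFun h 1) 1)
  have h01r := congrArg Complex.re (congrFun (congrFun h 0) 1)
  have h01i := congrArg Complex.im (congrFun (congrFun h 0) 1)
  simp at h00 h11 h01r h01i
  refine ⟨by linarith, ?_⟩
  ext i
  fin_cases i <;> simp <;> linarith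

theorem norm_sq_eq (x : Vec) : ‖x‖ ^ 2 = x 0 ^ 2 + x 1 ^ 2 + x 2 ^ 2 := by
  rw [← real_inner_self_eq_norm_sq, inner_eq]; ring

/-- The eigenvalues are `a ± ‖x‖`; the trace `2a` and the determinant `a² - ‖x‖²` detect their
signs. -/
theorem posSemidef_pauliOp {a : ℝ} {x : Vec} : (pauliOp a x).PosSemidef ↔ ‖x‖ ≤ a := by
  constructor
  · intro h
    have h0 := h.trace_nonneg
    rw [trace_pauliOp, Complex.zero_le_real] at h0
    have h1 := h.det_nonneg
    have h2 : (pauliOp a x).det = ((a ^ 2 - ‖x‖ ^ 2 : ℝ) : ℂ) := by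
      rw [pauliOp_eq, Matrix.det_fin_two, norm_sq_eq]
      simp
      linear_combination ((x 1 : ℂ) ^ 2) * Complex.I_sq
    rw [h2, Complex.zero_le_real] at h1
    exact abs_le_of_sq_le_sq' (by linarith) (by linarith) |>.2
  · intro h
    refine .of_dotProduct_mulVec_nonneg (isHermitian_pauliOp a x) fun w => ?_
    -- `n` and `y` are the unnormalized Bloch coordinates of the projector on `w`: `n` is the
    -- squared norm of `w` and `‖y‖ = n`, so Cauchy–Schwarz bounds the quadratic form `a n + ⟨x,
    -- y⟩`.
    set y : Vec := !₂[2 * ((w 0).re * (w 1).re + (w 0).im * (w 1).im),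
      2 * ((w 0).re * (w 1).im - (w 0).im * (w 1).re),
      (w 0).re ^ 2 + (w 0).im ^ 2 - (w 1).re ^ 2 - (w 1).im ^ 2] with hy
    set n : ℝ := (w 0).re ^ 2 + (w 0).im ^ 2 + (w 1).re ^ 2 + (w 1).im ^ 2 with hn
    have hn0 : 0 ≤ n := by positivity
    have hyn : ‖y‖ ≤ n := by
      apply (abs_le_of_sq_le_sq' _ hn0).2
      rw [norm_sq_eq]
      simp [hy, hn]
      apply le_of_eq; ring
    have key : star w ⬝ᵥ (pauliOp a x).mulVec w = ((a * n + inner ℝ x y : ℝ) : ℂ) := by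
      rw [pauliOp_eq, inner_eq]
      apply Complex.ext <;>
        simp [dotProduct, Matrix.mulVec, Fin.sum_univ_two, hy, hn, pow_two] <;> ring
    rw [key, Complex.zero_le_real]
    have h1 := (abs_le.1 (abs_real_inner_le_norm x y)).1
    have h2 : ‖x‖ * ‖y‖ ≤ a * n := mul_le_mul h hyn (norm_nonneg _) ((norm_nonneg _).trans h)
    linarith

/-! ### Convex hulls, relative interiors and the minimax point -/

section Convexity

variable {E : Type*} [NormedAddCommGroup E] [InnerProductSpace ℝ E]

theorem mem_convexHull_image_iff {ι : Type*} [Fintype ι] {s : ι → E} {A : Set ι} {x : E} :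
    x ∈ convexHull ℝ (s '' A) ↔
      ∃ t : ι → ℝ, (∀ i, 0 ≤ t i) ∧ (∀ i ∉ A, t i = 0) ∧ ∑ i, t i = 1 ∧ ∑ i, t i • s i = x := by
  classical
  constructor
  · rw [mem_convexHull_iff_exists_fintype]
    rintro ⟨κ, _, w, z, hw, hw1, hz, rfl⟩
    choose g hgA hg using hz
    -- Weights of repeated points are collected along the fibres of `g`.
    refine ⟨fun i => ∑ k, if g k = i then w k else 0, fun i => Finset.sum_nonneg fun k _ => ?_,
      fun i hi => Finset.sum_eq_zero fun k _ => ?_, ?_, ?_⟩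
    · split_ifs
      exacts [hw k, le_rfl]
    · rw [if_neg]
      rintro rfl
      exact hi (hgA k)
    · rw [Finset.sum_comm]
      simpa using hw1
    · simp_rw [Finset.sum_smul]
      rw [Finset.sum_comm]
      simp [ite_smul, hg]
  · rintro ⟨t, ht, htA, ht1, rfl⟩
    have h0 : ∀ i ∈ Finset.univ, i ∉ Finset.univ.filter (· ∈ A) → t i = 0 := fun i _ hi =>
      htA i (by simpa using hi)
    rw [← Finset.sum_subset (Finset.filter_subset (· ∈ A) _)
      fun i hi hi' => by rw [h0 i hi hi', zero_smul]]
    refine (convex_convexHull ℝ _).sum_mem (fun i _ => ht i) ?_ fun i hi =>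
      subset_convexHull ℝ _ ⟨i, by simpa using hi, rfl⟩
    rw [Finset.sum_subset (Finset.filter_subset (· ∈ A) _) h0, ht1]

theorem mem_intrinsicInterior_of_isOpen {S U : Set E} {x : E} (hx : x ∈ S) (hU : IsOpen U)
    (hxU : x ∈ U) (h : ∀ y ∈ U, y ∈ affineSpan ℝ S → y ∈ S) : x ∈ intrinsicInterior ℝ S := by
  rw [mem_intrinsicInterior]
  refine ⟨⟨x, subset_affineSpan ℝ S hx⟩, ?_, rfl⟩
  rw [mem_interior]
  exact ⟨{y : affineSpan ℝ S | (y : E) ∈ U}, fun y hy => h y hy y.2,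
    hU.preimage continuous_subtype_val, hxU⟩

/-- From a point of the relative interior one can move away from any point of the set. -/
theorem exists_lineMap_mem_of_mem_intrinsicInterior {S : Set E} {x y : E}
    (hx : x ∈ intrinsicInterior ℝ S) (hy : y ∈ S) :
    ∃ ε : ℝ, 0 < ε ∧ x + ε • (x - y) ∈ S := by
  rw [mem_intrinsicInterior] at hx
  obtain ⟨x, hx, rfl⟩ := hx
  obtain ⟨U, hU, hUo, hxU⟩ := mem_interior.1 hx
  obtain ⟨V, hV, rfl⟩ := isOpen_induced_iff.1 hUo
  have hc : Filter.Tendsto (fun ε : ℝ => (x : E) + ε • ((x : E) - y)) (nhdsWithin 0 (Set.Ioi 0))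
      (nhds (x : E)) := by
    have : Continuous (fun ε : ℝ => (x : E) + ε • ((x : E) - y)) := by fun_prop
    have h2 := this.tendsto 0
    simp only [zero_smul, add_zero] at h2
    exact h2.mono_left nhdsWithin_le_nhds
  obtain ⟨ε, hε, hε0⟩ := ((hc.eventually (hV.mem_nhds hxU)).and self_mem_nhdsWithin).exists
  refine ⟨ε, hε0, ?_⟩
  have hm : (x : E) + ε • ((x : E) - y) ∈ affineSpan ℝ S := by
    have := AffineMap.lineMap_mem (1 + ε) (subset_affineSpan ℝ S hy) x.2
    convert this using 1
    rw [AffineMap.lineMap_apply_module]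
    module
  exact hU (a := ⟨_, hm⟩) hε

theorem norm_sub_smul_lt {w d : E} {ε : ℝ} (hε : 0 < ε)
    (hε' : ε * ‖d‖ ^ 2 < 2 * inner ℝ w d) : ‖w - ε • d‖ < ‖w‖ := by
  apply lt_of_pow_lt_pow_left₀ 2 (norm_nonneg _)
  rw [norm_sub_sq_real, inner_smul_right, norm_smul, mul_pow, Real.norm_eq_abs, sq_abs]
  nlinarith

variable [FiniteDimensional ℝ E]

/-- The maximum of the functions `q i + ‖s i - c‖` is continuous and tends to infinity with `c`, so
it attains its minimum. -/
theorem exists_isMinOn_sup_add_norm_sub {ι : Type*} [Fintype ι] [Nonempty ι] (q : ι → ℝ)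
    (s : ι → E) : ∃ c : E, ∃ k : ℝ, (∀ i, q i + ‖s i - c‖ ≤ k) ∧
      ∀ c' : E, ∃ i, k ≤ q i + ‖s i - c'‖ := by
  let f : E → ℝ := fun c => Finset.univ.sup' Finset.univ_nonempty fun i => q i + ‖s i - c‖
  have hf : Continuous f := by
    apply Continuous.finset_sup'_apply
    intro i _
    fun_prop
  have hlim : Filter.Tendsto f (Filter.cocompact E) Filter.atTop := by
    obtain ⟨i⟩ := ‹Nonempty ι›
    refine Filter.tendsto_atTop_mono (f := fun c => q i - ‖s i‖ + ‖c‖) (fun c => ?_)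
      (Filter.tendsto_atTop_add_const_left _ _ tendsto_norm_cocompact_atTop)
    refine le_trans ?_ (Finset.le_sup' (fun i => q i + ‖s i - c‖) (Finset.mem_univ i))
    have := norm_sub_norm_le c (s i)
    rw [norm_sub_rev] at this
    show q i - ‖s i‖ + ‖c‖ ≤ q i + ‖s i - c‖
    linarith
  obtain ⟨c, hc⟩ := hf.exists_forall_le hlim
  refine ⟨c, f c, fun i => Finset.le_sup' (fun i => q i + ‖s i - c‖) (Finset.mem_univ i), ?_⟩
  intro c'
  obtain ⟨i, -, hi⟩ := Finset.exists_mem_eq_sup' Finset.univ_nonempty fun i => q i + ‖s i - c'‖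
  exact ⟨i, hi ▸ hc c'⟩

/-- Weighted minimax point: some `c` is a convex combination of those points `s i` for which
`q i + ‖s i - c‖` is maximal. -/
theorem exists_minimax_convexCombination {ι : Type*} [Fintype ι] [Nonempty ι] (q : ι → ℝ)
    (s : ι → E) : ∃ c : E, ∃ k : ℝ, ∃ t : ι → ℝ, (∀ i, 0 ≤ t i) ∧ ∑ i, t i = 1 ∧
      ∑ i, t i • s i = c ∧ (∀ i, q i + ‖s i - c‖ ≤ k) ∧
      ∀ i, t i ≠ 0 → q i + ‖s i - c‖ = k := by
  classical
  obtain ⟨c, k, hk, hmin⟩ := exists_isMinOn_sup_add_norm_sub q s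
  let A : Finset ι := Finset.univ.filter fun i => q i + ‖s i - c‖ = k
  have hA : c ∈ convexHull ℝ (s '' (A : Set ι)) := by
    -- Otherwise a hyperplane separates `c` from the active points. A small move along its normal
    -- `d` strictly decreases every active distance, while inactive terms stay below `k` by
    -- continuity; this contradicts minimality.
    by_contra hc
    have hcl : IsClosed (convexHull ℝ (s '' (A : Set ι))) :=
      ((A.finite_toSet.image s).isClosed_convexHull ℝ)
    obtain ⟨f, u, hfc, hfs⟩ := geometric_hahn_banach_point_closed (convex_convexHull ℝ _) hcl hc
    set d : E := (InnerProductSpace.toDual ℝ E).symm f with hd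
    have hdf : ∀ x, inner ℝ x d = f x := fun x => by
      rw [real_inner_comm, hd, InnerProductSpace.toDual_symm_apply]
    have hev : ∀ i, ∀ᶠ ε in nhdsWithin (0 : ℝ) (Set.Ioi 0), q i + ‖s i - (c + ε • d)‖ < k := by
      intro i
      by_cases hi : q i + ‖s i - c‖ = k
      · have hpos : 0 < inner ℝ (s i - c) d := by
          rw [hdf, map_sub]
          have := hfs (s i) (subset_convexHull ℝ _ ⟨i, by simp [A, hi], rfl⟩)
          linarith
        have h1 : ∀ᶠ ε in nhdsWithin (0 : ℝ) (Set.Ioi 0), ε * ‖d‖ ^ 2 < 2 * inner ℝ (s i - c) d := by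
          have hcont : Continuous fun ε : ℝ => ε * ‖d‖ ^ 2 := by fun_prop
          have := hcont.tendsto 0
          exact (this.mono_left nhdsWithin_le_nhds).eventually_lt_const (by simpa using hpos)
        filter_upwards [h1, self_mem_nhdsWithin] with ε h1 h2
        have := norm_sub_smul_lt h2 h1
        rw [← sub_sub]
        linarith
      · have hlt : q i + ‖s i - c‖ < k := lt_of_le_of_ne (hk i) hi
        have hcont : Continuous fun ε : ℝ => q i + ‖s i - (c + ε • d)‖ := by fun_prop
        have := hcont.tendsto 0
        exact (this.mono_left nhdsWithin_le_nhds).eventually_lt_const (by simpa using hlt)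
    obtain ⟨ε, hε⟩ := (Filter.eventually_all.2 hev).exists
    obtain ⟨i, hi⟩ := hmin (c + ε • d)
    exact absurd (hε i) (not_lt.2 hi)
  obtain ⟨t, ht0, htA, ht1, htc⟩ := mem_convexHull_image_iff.1 hA
  refine ⟨c, k, t, ht0, ht1, htc, hk, fun i hi => ?_⟩
  by_contra h
  exact hi (htA i (by simpa [A] using h))

end Convexity

/-! ### Coordinates with respect to the points `s i`, and the sets `Ω` and `Λ` -/

section LinearCoordinates

theorem linearIndependent_sPoint {N : ℕ} [NeZero N] {q : Fin N → ℝ} {v : Fin N → Vec}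
    (hD : affineDim (Set.range (sPoint q v)) = N - 1) :
    LinearIndependent ℝ fun i : {i : Fin N // i ≠ 0} => sPoint q v i := by
  have h : AffineIndependent ℝ (sPoint q v) := by
    rw [affineIndependent_iff_finrank_vectorSpan_eq ℝ _ (n := N - 1)
      (by have := NeZero.pos N; simp; omega), ← direction_affineSpan]
    exact hD
  rw [affineIndependent_iff_linearIndependent_vsub ℝ _ 0] at h
  simpa [sPoint] using h

/-- Since `s 0 = 0`, the coefficient at index `0` is invisible in the sum; the others are read off
by a linear left inverse, automatically continuous in finite dimension. -/
theorem exists_coordinates {N : ℕ} [NeZero N] {s : Fin N → Vec} (hs0 : s 0 = 0)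
    (hs : LinearIndependent ℝ fun i : {i : Fin N // i ≠ 0} => s i) :
    ∃ φ : Fin N → Vec →L[ℝ] ℝ, φ 0 = 0 ∧
      ∀ (t : Fin N → ℝ) (i : Fin N), i ≠ 0 → φ i (∑ j, t j • s j) = t i := by
  classical
  obtain ⟨g, hg⟩ := LinearMap.exists_leftInverse_of_injective
    (Fintype.linearCombination ℝ fun i : {i : Fin N // i ≠ 0} => s i)
    (LinearMap.ker_eq_bot.2 hs.fintypeLinearCombination_injective)
  refine ⟨fun i => if h : i ≠ 0 then
    LinearMap.toContinuousLinearMap ((LinearMap.proj ⟨i, h⟩).comp g) else 0, by simp, ?_⟩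
  intro t i hi
  have h1 : ∑ j, t j • s j = Fintype.linearCombination ℝ (fun i : {i : Fin N // i ≠ 0} => s i)
      (fun i => t i) := by
    rw [Fintype.linearCombination_apply,
      ← Finset.sum_subtype (Finset.univ.filter fun i => i ≠ 0) (by simp) (fun i => t i • s i),
      Finset.sum_filter]
    refine Finset.sum_congr rfl fun i _ => ?_
    by_cases hi : i = 0 <;> simp [hi, hs0]
  have h2 := LinearMap.congr_fun hg (fun i => t i)
  simp only [hi, ne_eq, not_false_eq_true, dite_true]
  rw [h1]
  exact congrFun h2 ⟨i, hi⟩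

variable {N : ℕ} [NeZero N] {q : Fin N → ℝ} {v : Fin N → Vec}

theorem sPoint_zero : sPoint q v 0 = 0 := by simp [sPoint]

theorem eq_of_sum_smul_sPoint_eq (hD : affineDim (Set.range (sPoint q v)) = N - 1)
    {t t' : Fin N → ℝ} (h : ∑ i, t i • sPoint q v i = ∑ i, t' i • sPoint q v i) (i : Fin N)
    (hi : i ≠ 0) : t i = t' i := by
  obtain ⟨φ, -, hφ⟩ := exists_coordinates sPoint_zero (linearIndependent_sPoint hD)
  rw [← hφ t i hi, h, hφ t' i hi]

theorem eq_of_isBarycentric (hD : affineDim (Set.range (sPoint q v)) = N - 1)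
    {t t' : Fin N → ℝ} (h1 : ∑ i, t i = 1) (h1' : ∑ i, t' i = 1)
    (h : ∑ i, t i • sPoint q v i = ∑ i, t' i • sPoint q v i) : t = t' := by
  have h2 := eq_of_sum_smul_sPoint_eq hD h
  funext i
  by_cases hi : i = 0
  · subst hi
    rw [← Finset.add_sum_erase _ _ (Finset.mem_univ 0)] at h1 h1'
    rw [Finset.sum_congr rfl fun i hi => h2 i (Finset.ne_of_mem_erase hi)] at h1
    linarith
  · exact h2 i hi

/-- A continuous coordinate system near points of the span of the `s i`. -/
theorem exists_coordinates_span (hD : affineDim (Set.range (sPoint q v)) = N - 1) :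
    ∃ φ : Fin N → Vec →L[ℝ] ℝ, φ 0 = 0 ∧
      (∀ (t : Fin N → ℝ) (i : Fin N), i ≠ 0 → φ i (∑ j, t j • sPoint q v j) = t i) ∧
      ∀ x ∈ Submodule.span ℝ (Set.range (sPoint q v)), ∑ i, φ i x • sPoint q v i = x := by
  obtain ⟨φ, hφ0, hφ⟩ := exists_coordinates sPoint_zero (linearIndependent_sPoint hD)
  refine ⟨φ, hφ0, hφ, fun x hx => ?_⟩
  obtain ⟨t, rfl⟩ := (Submodule.mem_span_range_iff_exists_fun ℝ).1 hx
  refine Finset.sum_congr rfl fun i _ => ?_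
  by_cases hi : i = 0
  · simp [hi, sPoint_zero]
  · rw [hφ t i hi]

theorem mem_convexHull_range_sPoint {x : Vec} : x ∈ convexHull ℝ (Set.range (sPoint q v)) ↔
    ∃ t : Fin N → ℝ, (∀ i, 0 ≤ t i) ∧ ∑ i, t i = 1 ∧ ∑ i, t i • sPoint q v i = x := by
  rw [← Set.image_univ, mem_convexHull_image_iff]
  simp

theorem isOpen_setOf_pos_off_zero (φ : Fin N → Vec →L[ℝ] ℝ) :
    IsOpen {x | ∀ i, i ≠ 0 → 0 < φ i x} := by
  simp only [Set.ofPred_forall]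
  exact isOpen_iInter_of_finite fun i => isOpen_iInter_of_finite fun _ =>
    isOpen_lt continuous_const (φ i).continuous

/-- A point of the relative interior can be pushed slightly away from the barycentre inside the
simplex; solving back gives each weight a positive share of `1 / N`. Conversely, positivity of all
weights is an open condition in the coordinates `φ`. -/
theorem mem_Omega_iff (hD : affineDim (Set.range (sPoint q v)) = N - 1) {c : Vec} :
    c ∈ Omega q v ↔ ∃ t, IsBarycentric q v c t := by
  constructor
  · intro hc
    have hN : (0 : ℝ) < N := by exact_mod_cast NeZero.pos N
    obtain ⟨ε, hε, h⟩ := exists_lineMap_mem_of_mem_intrinsicInterior hc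
      (mem_convexHull_range_sPoint.2 ⟨fun _ => (N : ℝ)⁻¹, fun _ => by positivity,
        by simp [hN.ne'], rfl⟩)
    obtain ⟨t, ht0, ht1, ht⟩ := mem_convexHull_range_sPoint.1 h
    refine ⟨fun i => (1 + ε)⁻¹ * (t i + ε * (N : ℝ)⁻¹), fun i => ?_, ?_, ?_⟩
    · have := ht0 i
      positivity
    · rw [← Finset.mul_sum, Finset.sum_add_distrib, ht1]
      simp
      field_simp
    · simp_rw [mul_smul, add_smul, ← Finset.smul_sum, Finset.sum_add_distrib, ht, mul_smul,
        ← Finset.smul_sum]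
      rw [inv_smul_eq_iff₀ (by positivity)]
      module
  · rintro ⟨t, ht0, ht1, rfl⟩
    obtain ⟨φ, hφ0, hφ, hφs⟩ := exists_coordinates_span hD
    have hsum : ∑ i, φ i (∑ j, t j • sPoint q v j) = 1 - t 0 := by
      rw [← ht1, ← Finset.add_sum_erase _ _ (Finset.mem_univ 0), hφ0,
        ← Finset.add_sum_erase _ t (Finset.mem_univ 0),
        Finset.sum_congr rfl fun i hi => hφ t i (Finset.ne_of_mem_erase hi)]
      simp
    refine mem_intrinsicInterior_of_isOpen
      (U := {x | (∀ i, i ≠ 0 → 0 < φ i x) ∧ ∑ i, φ i x < 1})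
      (mem_convexHull_range_sPoint.2 ⟨t, fun i => (ht0 i).le, ht1, rfl⟩) ?_ ?_ ?_
    · exact (isOpen_setOf_pos_off_zero φ).inter
        (isOpen_lt (continuous_finsetSum _ fun i _ => (φ i).continuous) continuous_const)
    · exact ⟨fun i hi => by rw [hφ t i hi]; exact ht0 i, by rw [hsum]; linarith [ht0 0]⟩
    · rintro y ⟨hy0, hy1⟩ hy
      rw [affineSpan_convexHull] at hy
      have hy2 := hφs y (affineSpan_subset_span hy)
      refine mem_convexHull_range_sPoint.2
        -- The missing mass is placed on `s 0 = 0`, where it does not move the point.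
        ⟨fun i => φ i y + if i = 0 then 1 - ∑ i, φ i y else 0, fun i => ?_, ?_, ?_⟩
      · by_cases hi : i = 0
        · simp [hi, hφ0, hy1.le]
        · simp [hi, (hy0 i hi).le]
      · simp [Finset.sum_add_distrib]
      · simp [add_smul, Finset.sum_add_distrib, ite_smul, sPoint_zero, hy2]

theorem sum_smul_mem_cone (hN : 2 ≤ N) {t : Fin N → ℝ} (ht : ∀ i, i ≠ 0 → 0 < t i) :
    ∑ i, t i • sPoint q v i ∈ {x | ∃ a : ℝ, 0 ≤ a ∧
      ∃ y ∈ convexHull ℝ (sPoint q v '' {i | i ≠ 0}), x = a • y} := by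
  set a := ∑ i ∈ Finset.univ.erase 0, t i with ha
  have hpos : 0 < a := Finset.sum_pos (fun i hi => ht i (Finset.ne_of_mem_erase hi))
    ⟨⟨1, hN⟩, by simp [Fin.ext_iff]⟩
  have hsum : ∑ i, (if i = 0 then 0 else a⁻¹ * t i) = 1 := by
    rw [← Finset.add_sum_erase _ _ (Finset.mem_univ 0),
      Finset.sum_congr rfl fun i hi => if_neg (Finset.ne_of_mem_erase hi), ← Finset.mul_sum, ← ha]
    simp [hpos.ne']
  refine ⟨a, hpos.le, a⁻¹ • ∑ i, t i • sPoint q v i, mem_convexHull_image_iff.2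
    ⟨fun i => if i = 0 then 0 else a⁻¹ * t i, fun i => ?_, fun i hi => ?_, hsum, ?_⟩,
    (smul_inv_smul₀ hpos.ne' _).symm⟩
  · by_cases hi : i = 0
    · simp [hi]
    · have := ht i hi
      simp only [hi, if_false]
      positivity
  · simp at hi
    simp [hi]
  · rw [Finset.smul_sum]
    refine Finset.sum_congr rfl fun i _ => ?_
    by_cases hi : i = 0
    · simp [hi, sPoint_zero]
    · simp [hi, mul_smul]

/-- Same argument as for `Ω`, pushing away from `∑ i, s i`; no normalization of the weights is
needed in a cone. -/
theorem mem_Lambda_iff (hN : 2 ≤ N) (hD : affineDim (Set.range (sPoint q v)) = N - 1) {c : Vec} :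
    c ∈ Lambda q v ↔
      ∃ t : Fin N → ℝ, (∀ i, i ≠ 0 → 0 < t i) ∧ ∑ i, t i • sPoint q v i = c := by
  constructor
  · intro hc
    obtain ⟨ε, hε, a, ha, y, hy, h⟩ := exists_lineMap_mem_of_mem_intrinsicInterior hc
      (sum_smul_mem_cone hN (t := fun _ => 1) fun _ _ => one_pos)
    obtain ⟨t, ht0, -, -, rfl⟩ := mem_convexHull_image_iff.1 hy
    refine ⟨fun i => (1 + ε)⁻¹ * (a * t i + ε * 1), fun i _ => ?_, ?_⟩
    · have := ht0 i
      positivity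
    · simp_rw [mul_smul, add_smul, ← Finset.smul_sum, Finset.sum_add_distrib, mul_smul,
        ← Finset.smul_sum, ← h]
      rw [inv_smul_eq_iff₀ (by positivity)]
      simp only [one_smul]
      module
  · rintro ⟨t, ht0, rfl⟩
    obtain ⟨φ, hφ0, hφ, hφs⟩ := exists_coordinates_span hD
    refine mem_intrinsicInterior_of_isOpen (U := {x | ∀ i, i ≠ 0 → 0 < φ i x})
      (sum_smul_mem_cone hN ht0) (isOpen_setOf_pos_off_zero φ) ?_ ?_
    · exact fun i hi => by rw [hφ t i hi]; exact ht0 i hi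
    · intro y hy0 hy
      have hsub : affineSpan ℝ {x | ∃ a : ℝ, 0 ≤ a ∧
          ∃ y ∈ convexHull ℝ (sPoint q v '' {i | i ≠ 0}), x = a • y} ≤
          (Submodule.span ℝ (Set.range (sPoint q v))).toAffineSubspace := by
        rw [affineSpan_le]
        rintro _ ⟨a, -, y, hy, rfl⟩
        refine Submodule.smul_mem _ a (convexHull_min ?_ (Submodule.convex _) hy)
        rintro _ ⟨i, -, rfl⟩
        exact Submodule.subset_span ⟨i, rfl⟩
      rw [← hφs y (hsub hy)]
      exact sum_smul_mem_cone hN hy0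

end LinearCoordinates

/-! ### Measurements in Bloch coordinates -/

section Measurements

variable {ι : Type*} [Fintype ι]

theorem isPOVM_pauliOp {p : ι → ℝ} {y : ι → Vec} :
    IsPOVM (fun i => pauliOp (p i) (y i)) ↔
      (∀ i, ‖y i‖ ≤ p i) ∧ ∑ i, p i = 1 ∧ ∑ i, y i = 0 := by
  simp only [IsPOVM, posSemidef_pauliOp, pauliOp_sum, ← pauliOp_one, pauliOp_inj]

theorem IsPOVM.exists_pauliOp {M : ι → Op} (hM : IsPOVM M) :
    ∃ p : ι → ℝ, ∃ y : ι → Vec, M = fun i => pauliOp (p i) (y i) := by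
  choose p y h using fun i => QubitMD.exists_pauliOp (hM.1 i).isHermitian
  exact ⟨p, y, funext h⟩

theorem successProb_pauliOp (q : ι → ℝ) (v : ι → Vec) (p : ι → ℝ) (y : ι → Vec) :
    successProb q (fun i => blochState (v i)) (fun i => pauliOp (p i) (y i)) =
      ∑ i, q i * (p i + inner ℝ (v i) (y i)) := by
  refine Finset.sum_congr rfl fun i _ => ?_
  beta_reduce
  rw [blochState_eq, trace_pauliOp_mul, Complex.ofReal_re, real_inner_smul_left]
  ring

/-- An ensemble is optimized with fewer outcomes if and only if some minimum-error measurement has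
a vanishing element. -/
theorem optimizedWithFewer_iff {q : ι → ℝ} {ρ : ι → Op} :
    OptimizedWithFewer q ρ ↔ ∃ M, IsOptimal q ρ M ∧ ∃ j, M j = 0 := by
  classical
  constructor
  · rintro ⟨χ, hχ, M, hM, hopt⟩
    obtain ⟨j, hj⟩ : ∃ j, j ∉ χ := by
      by_contra! h
      rw [Finset.eq_univ_iff_forall.2 h] at hχ
      exact hχ.ne rfl
    -- A measurement on `χ` is extended by zero outside `χ`.
    set M' : ι → Op := fun i => if h : i ∈ χ then M ⟨i, h⟩ else 0 with hM'
    have hres : ∀ i : χ, M' i = M i := fun i => by simp [hM']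
    have hzero : ∀ i ∉ χ, M' i = 0 := fun i hi => by simp [hM', hi]
    have hsuc : successProb q ρ M' = successProb (fun i : χ => q i) (fun i : χ => ρ i) M := by
      unfold successProb
      rw [← Finset.sum_subset (Finset.subset_univ χ) fun i _ hi => by simp [hzero i hi],
        ← Finset.sum_coe_sort]
      simp [hres]
    refine ⟨M', ⟨⟨fun i => ?_, ?_⟩, fun M'' h => hsuc ▸ hopt M'' h⟩, j, hzero j hj⟩
    · by_cases hi : i ∈ χ
      · rw [hres ⟨i, hi⟩]
        exact hM.1 _
      · rw [hzero i hi]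
        exact .zero
    · rw [← Finset.sum_subset (Finset.subset_univ χ) fun i _ hi => hzero i hi,
        ← Finset.sum_coe_sort]
      simpa [hres] using hM.2
  · rintro ⟨M, ⟨hM, hopt⟩, j, hj⟩
    have hzero : ∀ i ∈ Finset.univ, i ∉ Finset.univ.erase j → M i = 0 := fun i _ hi => by
      have : i = j := by simpa using hi
      rw [this, hj]
    refine ⟨Finset.univ.erase j, Finset.card_erase_lt_of_mem (Finset.mem_univ j),
      fun i => M i, ⟨fun i => hM.1 i, ?_⟩, fun M' h => (hopt M' h).trans_eq ?_⟩
    · rw [Finset.sum_coe_sort (Finset.univ.erase j) M,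
        Finset.sum_subset (Finset.subset_univ _) hzero]
      exact hM.2
    · unfold successProb
      rw [Finset.sum_coe_sort (Finset.univ.erase j) fun i => q i * ((ρ i * M i).trace).re]
      exact (Finset.sum_subset (Finset.subset_univ _)
        fun i h h' => by simp [hzero i h h']).symm

theorem guessProb_eq_of_isOptimal {q : ι → ℝ} {ρ M : ι → Op} (h : IsOptimal q ρ M) :
    guessProb q ρ = successProb q ρ M := by
  refine IsGreatest.csSup_eq ⟨⟨M, h.1, rfl⟩, ?_⟩
  rintro _ ⟨M', hM', rfl⟩
  exact h.2 M' hM'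

end Measurements

/-! ### Weak duality, the candidate measurement and the intersection point -/

section Duality

variable {N : ℕ} [NeZero N] {q : Fin N → ℝ} {v : Fin N → Vec}

/-- Because `∑ y i = 0`, all the vectors `q i v i` may be translated by the common vector `q 0 v 0 +
c`. -/
theorem successProb_eq_sum_sPoint (c : Vec) {p : Fin N → ℝ} {y : Fin N → Vec}
    (hy : ∑ i, y i = 0) :
    successProb q (fun i => blochState (v i)) (fun i => pauliOp (p i) (y i)) =
      ∑ i, (q i * p i + inner ℝ (sPoint q v i - c) (y i)) := by
  have h : ∑ i, inner ℝ (q 0 • v 0 + c) (y i) = 0 := by rw [← inner_sum, hy, inner_zero_right]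
  rw [successProb_pauliOp, ← sub_zero (∑ i, q i * (p i + inner ℝ (v i) (y i))), ← h,
    ← Finset.sum_sub_distrib]
  refine Finset.sum_congr rfl fun i _ => ?_
  simp only [sPoint, inner_sub_left, inner_add_left, real_inner_smul_left]
  ring

theorem inner_le_mul_norm {x y : Vec} {p : ℝ} (h : ‖y‖ ≤ p) : inner ℝ x y ≤ p * ‖x‖ :=
  (real_inner_le_norm x y).trans
    (by rw [mul_comm]; exact mul_le_mul_of_nonneg_right h (norm_nonneg _))

theorem successProb_le {c : Vec} {k : ℝ} (hk : ∀ i, q i + ‖sPoint q v i - c‖ ≤ k)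
    {M : Fin N → Op} (hM : IsPOVM M) : successProb q (fun i => blochState (v i)) M ≤ k := by
  obtain ⟨p, y, rfl⟩ := hM.exists_pauliOp
  obtain ⟨hyp, hp, hy⟩ := isPOVM_pauliOp.1 hM
  rw [successProb_eq_sum_sPoint c hy]
  calc ∑ i, (q i * p i + inner ℝ (sPoint q v i - c) (y i)) ≤ ∑ i, k * p i := by
        refine Finset.sum_le_sum fun i _ => ?_
        have h1 := inner_le_mul_norm (x := sPoint q v i - c) (hyp i)
        have h2 := mul_le_mul_of_nonneg_right (hk i) ((norm_nonneg _).trans (hyp i))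
        linarith
    _ = k := by rw [← Finset.mul_sum, hp, mul_one]

theorem povmOf_eq (c : Vec) (t : Fin N → ℝ) :
    povmOf q v c t = fun i => pauliOp (pOf q v c t i) (pOf q v c t i • uOf q v c i) := by
  funext i
  rw [povmOf, pauliOp, pauliDot_smul, smul_add]

/-- The norms in `pOf` and `uOf` cancel, so the vector parts are proportional to `t i (s i - c)` and
sum to zero. When `s i = c` both sides vanish, the inverse of zero being zero. -/
theorem pOf_smul_uOf (c : Vec) (t : Fin N → ℝ) (i : Fin N) :
    pOf q v c t i • uOf q v c i =
      (∑ j, t j * ‖sPoint q v j - c‖)⁻¹ • t i • (sPoint q v i - c) := by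
  by_cases h : sPoint q v i - c = 0
  · simp [uOf, h]
  · rw [pOf, uOf, smul_smul, smul_smul]
    congr 1
    have := norm_ne_zero_iff.2 h
    field_simp

theorem norm_uOf_le (c : Vec) (i : Fin N) : ‖uOf q v c i‖ ≤ 1 := by
  rw [uOf, norm_smul, norm_inv, norm_norm]
  exact inv_mul_le_one

theorem sum_smul_sub_eq_zero {c : Vec} {t : Fin N → ℝ} (ht1 : ∑ i, t i = 1)
    (htc : ∑ i, t i • sPoint q v i = c) : ∑ i, t i • (sPoint q v i - c) = 0 := by
  simp_rw [smul_sub, Finset.sum_sub_distrib, htc, ← Finset.sum_smul, ht1, one_smul, sub_self]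

theorem isPOVM_povmOf {c : Vec} {t : Fin N → ℝ} (ht0 : ∀ i, 0 ≤ t i) (ht1 : ∑ i, t i = 1)
    (htc : ∑ i, t i • sPoint q v i = c) (hT : 0 < ∑ j, t j * ‖sPoint q v j - c‖) :
    IsPOVM (povmOf q v c t) := by
  rw [povmOf_eq, isPOVM_pauliOp]
  have hp : ∀ i, 0 ≤ pOf q v c t i := fun i =>
    div_nonneg (mul_nonneg (ht0 i) (norm_nonneg _)) hT.le
  refine ⟨fun i => ?_, ?_, ?_⟩
  · rw [norm_smul, Real.norm_of_nonneg (hp i)]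
    exact mul_le_of_le_one_right (hp i) (norm_uOf_le c i)
  · simp only [pOf]
    rw [← Finset.sum_div, div_self hT.ne']
  · simp only [pOf_smul_uOf]
    rw [← Finset.smul_sum, sum_smul_sub_eq_zero ht1 htc, smul_zero]

theorem successProb_povmOf {c : Vec} {k : ℝ} {t : Fin N → ℝ} (ht1 : ∑ i, t i = 1)
    (htc : ∑ i, t i • sPoint q v i = c) (hT : 0 < ∑ j, t j * ‖sPoint q v j - c‖)
    (hk : ∀ i, t i ≠ 0 → q i + ‖sPoint q v i - c‖ = k) :
    successProb q (fun i => blochState (v i)) (povmOf q v c t) = k := by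
  have hy : ∑ i, pOf q v c t i • uOf q v c i = 0 := by
    simp only [pOf_smul_uOf]
    rw [← Finset.smul_sum, sum_smul_sub_eq_zero ht1 htc, smul_zero]
  have hp : ∑ i, pOf q v c t i = 1 := by
    simp only [pOf]
    rw [← Finset.sum_div, div_self hT.ne']
  rw [povmOf_eq, successProb_eq_sum_sPoint c hy, ← mul_one k, ← hp, Finset.mul_sum]
  refine Finset.sum_congr rfl fun i _ => ?_
  rw [pOf_smul_uOf, smul_smul, real_inner_smul_right, real_inner_self_eq_norm_sq, pOf]
  by_cases hi : t i = 0
  · simp [hi]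
  · rw [← hk i hi]
    field_simp

theorem isOptimal_povmOf {c : Vec} {k : ℝ} {t : Fin N → ℝ} (ht0 : ∀ i, 0 ≤ t i)
    (ht1 : ∑ i, t i = 1) (htc : ∑ i, t i • sPoint q v i = c)
    (hT : 0 < ∑ j, t j * ‖sPoint q v j - c‖) (hk : ∀ i, q i + ‖sPoint q v i - c‖ ≤ k)
    (hk' : ∀ i, t i ≠ 0 → q i + ‖sPoint q v i - c‖ = k) :
    IsOptimal q (fun i => blochState (v i)) (povmOf q v c t) :=
  ⟨isPOVM_povmOf ht0 ht1 htc hT, fun _ hM =>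
    (successProb_le hk hM).trans_eq (successProb_povmOf ht1 htc hT hk').symm⟩

theorem mem_hyperboloid_iff {c : Vec} {i : Fin N} :
    c ∈ hyperboloid q v i ↔ q i + ‖sPoint q v i - c‖ = q 0 + ‖c‖ := by
  rw [hyperboloid, Set.mem_ofPred_eq, eGap, norm_sub_rev]
  constructor <;> intro h <;> linarith

theorem exists_intersectionPoint_of_not_optimizedWithFewer (hN : 2 ≤ N)
    (hD : affineDim (Set.range (sPoint q v)) = N - 1)
    (h : ¬ OptimizedWithFewer q fun i => blochState (v i)) :
    ∃ c : Vec, IsIntersectionPoint q v c ∧ c ∈ Omega q v := by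
  rw [optimizedWithFewer_iff] at h
  obtain ⟨c, k, t, ht0, ht1, htc, hk, hk'⟩ := exists_minimax_convexCombination q (sPoint q v)
  have hnn : ∀ j ∈ Finset.univ, 0 ≤ t j * ‖sPoint q v j - c‖ := fun j _ =>
    mul_nonneg (ht0 j) (norm_nonneg _)
  rcases (Finset.sum_nonneg hnn).eq_or_lt with hT | hT
  -- Here every point with positive weight coincides with `c`, so `k = q i` for such an `i`, and
  -- always guessing `i` is optimal; as `N ≥ 2`, this measurement has a zero element.
  · exfalso
    obtain ⟨i, hi⟩ : ∃ i, t i ≠ 0 := by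
      by_contra! h0
      simp [h0] at ht1
    have hri : ‖sPoint q v i - c‖ = 0 :=
      (mul_eq_zero.1 ((Finset.sum_eq_zero_iff_of_nonneg hnn).1 hT.symm i
        (Finset.mem_univ i))).resolve_left hi
    have hqi : q i = k := by rw [← hk' i hi, hri, add_zero]
    have hcast : (fun j => if j = i then (1 : Op) else 0) =
        fun j => pauliOp (if j = i then 1 else 0) 0 := by
      funext j
      split_ifs
      exacts [pauliOp_one.symm, pauliOp_zero.symm]
    have : Nontrivial (Fin N) := Fin.nontrivial_iff_two_le.2 hN
    obtain ⟨j, hj⟩ := exists_ne i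
    refine h ⟨fun j => if j = i then 1 else 0, ⟨?_, fun M hM => ?_⟩, j, if_neg hj⟩
    · rw [hcast, isPOVM_pauliOp]
      refine ⟨fun j => ?_, by simp, by simp⟩
      split_ifs <;> simp
    · refine (successProb_le hk hM).trans_eq ?_
      rw [hcast, successProb_pauliOp]
      simp [hqi]
  · have hopt := isOptimal_povmOf ht0 ht1 htc hT hk hk'
    have hpos : ∀ i, 0 < t i := fun i => by
      refine (ht0 i).lt_of_ne' fun hi => h ⟨_, hopt, i, ?_⟩
      simp [povmOf, pOf, hi]
    have h0 := hk' 0 (hpos 0).ne'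
    rw [sPoint_zero, zero_sub, norm_neg] at h0
    refine ⟨c, ⟨fun i _ => ?_, ?_⟩, (mem_Omega_iff hD).2 ⟨t, hpos, ht1, htc⟩⟩
    · rw [mem_hyperboloid_iff, h0, hk' i (hpos i).ne']
    · exact (mem_Lambda_iff hN hD).2 ⟨t, fun i _ => hpos i, htc⟩

/-- Squaring the hyperboloid equations gives `⟨s i, c' - c⟩ = -e i (‖c'‖ - ‖c‖)` with `e i ≥ 0`. If
`‖c'‖ > ‖c‖`, positive combination yields `⟨c', c' - c⟩ ≤ 0`, which Cauchy–Schwarz forbids. -/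
theorem norm_le_of_mem_hyperboloid (hq_max : ∀ i, q i ≤ q 0) {c c' : Vec}
    (hc : ∀ i, i ≠ 0 → c ∈ hyperboloid q v i) (hc' : ∀ i, i ≠ 0 → c' ∈ hyperboloid q v i)
    {t : Fin N → ℝ} (ht : ∀ i, i ≠ 0 → 0 < t i) (htc : ∑ i, t i • sPoint q v i = c') :
    ‖c'‖ ≤ ‖c‖ := by
  by_contra! hlt
  have key : ∀ i, t i * inner ℝ (sPoint q v i) (c' - c) ≤ 0 := by
    intro i
    by_cases hi : i = 0
    · simp [hi, sPoint_zero]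
    · have h1 := mem_hyperboloid_iff.1 (hc i hi)
      have h2 := mem_hyperboloid_iff.1 (hc' i hi)
      have h3 := norm_sub_sq_real (sPoint q v i) c
      have h4 := norm_sub_sq_real (sPoint q v i) c'
      rw [show ‖sPoint q v i - c‖ = q 0 - q i + ‖c‖ by linarith] at h3
      rw [show ‖sPoint q v i - c'‖ = q 0 - q i + ‖c'‖ by linarith] at h4
      have h5 : inner ℝ (sPoint q v i) (c' - c) = -((q 0 - q i) * (‖c'‖ - ‖c‖)) := by
        rw [inner_sub_right]
        linarith
      rw [h5]
      have h6 := mul_nonneg (ht i hi).le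
        (mul_nonneg (sub_nonneg.2 (hq_max i)) (sub_nonneg.2 hlt.le))
      linarith
  have hsum : inner ℝ c' (c' - c) ≤ 0 := by
    have hx : ∀ x, inner ℝ c' x = ∑ i, inner ℝ (t i • sPoint q v i) x := fun x => by
      rw [← htc, sum_inner]
    rw [hx]
    refine Finset.sum_nonpos fun i _ => ?_
    rw [real_inner_smul_left]
    exact key i
  rw [inner_sub_right, real_inner_self_eq_norm_sq] at hsum
  have := real_inner_le_norm c' c
  nlinarith [norm_nonneg c]

theorem IsIntersectionPoint.unique (hN : 2 ≤ N)
    (hD : affineDim (Set.range (sPoint q v)) = N - 1) (hq_max : ∀ i, q i ≤ q 0) {c c' : Vec}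
    (hc : IsIntersectionPoint q v c) (hc' : IsIntersectionPoint q v c') : c = c' := by
  obtain ⟨t, ht, htc⟩ := (mem_Lambda_iff hN hD).1 hc.2
  obtain ⟨t', ht', htc'⟩ := (mem_Lambda_iff hN hD).1 hc'.2
  have hn : ‖c‖ = ‖c'‖ := le_antisymm (norm_le_of_mem_hyperboloid hq_max hc'.1 hc.1 ht htc)
    (norm_le_of_mem_hyperboloid hq_max hc.1 hc'.1 ht' htc')
  -- With equal norms, `c - c'` is orthogonal to every `s i`, yet it lies in their span.
  have key : ∀ i, inner ℝ (sPoint q v i) (c - c') = 0 := by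
    intro i
    by_cases hi : i = 0
    · simp [hi, sPoint_zero]
    · have h1 := mem_hyperboloid_iff.1 (hc.1 i hi)
      have h2 := mem_hyperboloid_iff.1 (hc'.1 i hi)
      have h3 := norm_sub_sq_real (sPoint q v i) c
      have h4 := norm_sub_sq_real (sPoint q v i) c'
      rw [show ‖sPoint q v i - c‖ = ‖sPoint q v i - c'‖ by linarith, hn] at h3
      rw [inner_sub_right]
      linarith
  rw [← sub_eq_zero, ← inner_self_eq_zero (𝕜 := ℝ)]
  nth_rw 1 [← htc, ← htc']
  simp_rw [inner_sub_left, sum_inner, real_inner_smul_left, key]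
  simp

end Duality

/-! ### Uniqueness of the measurement, the dual operator and the complementary states -/

section Uniqueness

variable {N : ℕ} [NeZero N] {q : Fin N → ℝ} {v : Fin N → Vec}

/-- The `t`-average of `‖s i - c'‖²` exceeds that of `‖s i - c‖²` by exactly `‖c - c'‖²`. -/
theorem eq_of_norm_sPoint_sub_le {c c' : Vec} {t : Fin N → ℝ} (ht : ∀ i, 0 ≤ t i)
    (ht1 : ∑ i, t i = 1) (htc : ∑ i, t i • sPoint q v i = c)
    (h : ∀ i, ‖sPoint q v i - c'‖ ≤ ‖sPoint q v i - c‖) : c' = c := by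
  have h1 : ∀ i, t i * ‖c - c'‖ ^ 2 ≤ -2 * inner ℝ (t i • (sPoint q v i - c)) (c - c') := by
    intro i
    have h2 := norm_add_sq_real (sPoint q v i - c) (c - c')
    rw [sub_add_sub_cancel] at h2
    have h3 := pow_le_pow_left₀ (norm_nonneg _) (h i) 2
    have h4 : ‖c - c'‖ ^ 2 ≤ -2 * inner ℝ (sPoint q v i - c) (c - c') := by linarith
    have h5 := mul_le_mul_of_nonneg_left h4 (ht i)
    rw [real_inner_smul_left]
    linarith
  have h2 := Finset.sum_le_sum fun i (_ : i ∈ Finset.univ) => h1 i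
  rw [← Finset.sum_mul, ht1, ← Finset.mul_sum, ← sum_inner, sum_smul_sub_eq_zero ht1 htc,
    inner_zero_left] at h2
  have h3 : ‖c - c'‖ = 0 := by
    have := sq_nonneg ‖c - c'‖
    exact pow_eq_zero_iff two_ne_zero |>.1 (by linarith)
  exact (sub_eq_zero.1 (norm_eq_zero.1 h3)).symm

/-- If `c` were the vertex `s i`, its barycentric coordinates would vanish at every other index, and
`N ≥ 2` provides one. -/
theorem norm_sPoint_sub_pos (hN : 2 ≤ N) (hD : affineDim (Set.range (sPoint q v)) = N - 1)
    {c : Vec} {t : Fin N → ℝ} (ht : IsBarycentric q v c t) (i : Fin N) :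
    0 < ‖sPoint q v i - c‖ := by
  rw [norm_pos_iff, sub_ne_zero]
  intro h
  have h1 : t = Pi.single i 1 := eq_of_isBarycentric hD ht.2.1 (by simp) (by
    rw [ht.2.2, ← h]
    simp [Pi.single_apply, ite_smul])
  have : Nontrivial (Fin N) := Fin.nontrivial_iff_two_le.2 hN
  obtain ⟨j, hj⟩ := exists_ne i
  have h2 := ht.1 j
  rw [h1, Pi.single_eq_of_ne hj] at h2
  exact h2.false

/-- Equality case of Cauchy–Schwarz: the squared norm of the difference is `‖y‖² - p² ≤ 0`. -/
theorem eq_smul_of_inner_eq {x y : Vec} {p : ℝ} (hx : 0 < ‖x‖) (hy : ‖y‖ ≤ p)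
    (h : inner ℝ x y = p * ‖x‖) : y = (p * ‖x‖⁻¹) • x := by
  rw [← sub_eq_zero, ← norm_eq_zero, ← pow_eq_zero_iff two_ne_zero]
  apply le_antisymm _ (sq_nonneg _)
  rw [norm_sub_sq_real, real_inner_smul_right, real_inner_comm, h, norm_smul, mul_pow,
    Real.norm_eq_abs, sq_abs]
  have h1 := pow_le_pow_left₀ (norm_nonneg _) hy 2
  have h2 : p * ‖x‖⁻¹ * (p * ‖x‖) = p ^ 2 := by field_simp
  have h3 : (p * ‖x‖⁻¹) ^ 2 * ‖x‖ ^ 2 = p ^ 2 := by field_simp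
  rw [h2, h3]
  linarith

theorem eq_povmOf_of_le_successProb (hN : 2 ≤ N)
    (hD : affineDim (Set.range (sPoint q v)) = N - 1) {c : Vec} {k : ℝ} {t : Fin N → ℝ}
    (ht : IsBarycentric q v c t) (hk : ∀ i, q i + ‖sPoint q v i - c‖ = k) {M : Fin N → Op}
    (hM : IsPOVM M) (h : k ≤ successProb q (fun i => blochState (v i)) M) :
    M = povmOf q v c t := by
  have hr := norm_sPoint_sub_pos hN hD ht
  obtain ⟨p, y, rfl⟩ := hM.exists_pauliOp
  obtain ⟨hyp, hp, hy⟩ := isPOVM_pauliOp.1 hM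
  rw [successProb_eq_sum_sPoint c hy, ← mul_one k, ← hp, Finset.mul_sum] at h
  have hle : ∀ i ∈ Finset.univ, q i * p i + inner ℝ (sPoint q v i - c) (y i) ≤ k * p i := by
    intro i _
    have h1 := inner_le_mul_norm (x := sPoint q v i - c) (hyp i)
    rw [← hk i]
    linarith
  have heq := (Finset.sum_eq_sum_iff_of_le hle).1 (le_antisymm (Finset.sum_le_sum hle) h)
  have hyi : ∀ i, y i = (p i * ‖sPoint q v i - c‖⁻¹) • (sPoint q v i - c) := fun i => by
    refine eq_smul_of_inner_eq (hr i) (hyp i) ?_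
    have := heq i (Finset.mem_univ i)
    rw [← hk i] at this
    linarith
  -- The condition `∑ y i = 0` says `∑ m i (s i - c) = 0`: the `m i` are unnormalized barycentric
  -- coordinates of `c`, hence `m = T t`.
  set m : Fin N → ℝ := fun i => p i * ‖sPoint q v i - c‖⁻¹ with hm
  have hpm : ∀ i, p i = m i * ‖sPoint q v i - c‖ := fun i => by
    have := (hr i).ne'
    simp only [hm]
    field_simp
  have hm0 : ∀ i, 0 ≤ m i := fun i =>
    mul_nonneg ((norm_nonneg _).trans (hyp i)) (inv_nonneg.2 (norm_nonneg _))
  set T := ∑ i, m i with hT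
  have hTpos : 0 < T := by
    refine (Finset.sum_nonneg fun i _ => hm0 i).lt_of_ne' fun h0 => ?_
    have h1 := (Finset.sum_eq_zero_iff_of_nonneg fun i _ => hm0 i).1 h0
    simp [hpm, h1] at hp
  have hmc : ∑ i, m i • sPoint q v i = T • c := by
    have h1 : ∑ i, m i • (sPoint q v i - c) = 0 := by
      rw [← hy]
      exact Finset.sum_congr rfl fun i _ => (hyi i).symm
    simpa [smul_sub, Finset.sum_sub_distrib, ← Finset.sum_smul, sub_eq_zero] using h1
  have hmt : (fun i => T⁻¹ * m i) = t := by
    refine eq_of_isBarycentric hD ?_ ht.2.1 ?_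
    · rw [← Finset.mul_sum, ← hT, inv_mul_cancel₀ hTpos.ne']
    · simp_rw [mul_smul, ← Finset.smul_sum]
      rw [hmc, ht.2.2, inv_smul_smul₀ hTpos.ne']
  have hmt' : ∀ i, m i = T * t i := fun i => by
    rw [← hmt]
    field_simp
  have hTR : T * ∑ j, t j * ‖sPoint q v j - c‖ = 1 := by
    rw [← hp, Finset.mul_sum]
    refine Finset.sum_congr rfl fun i _ => ?_
    rw [hpm, hmt', mul_assoc]
  have hTinv : (∑ j, t j * ‖sPoint q v j - c‖)⁻¹ = T := (eq_inv_of_mul_eq_one_left hTR).symm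
  rw [povmOf_eq]
  funext i
  rw [pauliOp_inj, pOf_smul_uOf, hTinv, smul_smul, ← hmt', pOf, div_eq_mul_inv, hTinv]
  exact ⟨by rw [hpm, hmt']; ring, hyi i⟩

theorem isDualFeasible_pauliOp {c : Vec} {k : ℝ} :
    IsDualFeasible q (fun i => blochState (v i))
      (pauliOp (k / 2) ((1 / 2 : ℝ) • (c + q 0 • v 0))) ↔
      ∀ i, q i + ‖sPoint q v i - c‖ ≤ k := by
  refine forall_congr' fun i => ?_
  beta_reduce
  rw [blochState_eq, pauliOp_smul, pauliOp_sub, posSemidef_pauliOp,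
    show (1 / 2 : ℝ) • (c + q 0 • v 0) - q i • (1 / 2 : ℝ) • v i =
      (-(1 / 2) : ℝ) • (sPoint q v i - c) by rw [sPoint]; module,
    norm_smul, norm_neg, Real.norm_of_nonneg (by norm_num)]
  constructor <;> intro h <;> linarith

theorem IsDualFeasible.exists_pauliOp {K : Op}
    (hK : IsDualFeasible q (fun i => blochState (v i)) K) :
    ∃ (k : ℝ) (c : Vec), K = pauliOp (k / 2) ((1 / 2 : ℝ) • (c + q 0 • v 0)) := by
  obtain ⟨b, z, h⟩ := QubitMD.exists_pauliOp (hK 0).isHermitian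
  -- `K` is `pauliOp b z` plus `q 0 ρ 0`, whose coordinates are `q 0 / 2` and `q 0 v 0 / 2`.
  refine ⟨2 * b + q 0, (2 : ℝ) • z, ?_⟩
  beta_reduce at h
  rw [sub_eq_iff_eq_add, blochState_eq, pauliOp_smul, pauliOp_add] at h
  rw [h, pauliOp_inj]
  exact ⟨by ring, by module⟩

theorem isDualOptimal_iff {c : Vec} {k : ℝ} {t : Fin N → ℝ}
    (ht : IsBarycentric q v c t) (hk : ∀ i, q i + ‖sPoint q v i - c‖ = k) {K : Op} :
    IsDualOptimal q (fun i => blochState (v i)) K ↔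
      K = pauliOp (k / 2) ((1 / 2 : ℝ) • (c + q 0 • v 0)) := by
  -- A feasible pair with `k' ≤ k` has a centre no farther than `c` from every `s i`, so it is the
  -- same centre; then constraint `0` gives `k ≤ k'`.
  have hle : ∀ {k' c'}, k' ≤ k → (∀ i, q i + ‖sPoint q v i - c'‖ ≤ k') → k' = k ∧ c' = c := by
    intro k' c' hkk h
    have hc : c' = c := eq_of_norm_sPoint_sub_le (fun i => (ht.1 i).le) ht.2.1 ht.2.2 fun i => by
      linarith [h i, hk i]
    refine ⟨le_antisymm hkk ?_, hc⟩
    rw [← hk 0, ← hc]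
    exact h 0
  have hfeas := isDualFeasible_pauliOp.2 fun i => (hk i).le
  constructor
  · rintro ⟨hK, hopt⟩
    obtain ⟨k', c', rfl⟩ := hK.exists_pauliOp
    have h := hopt _ hfeas
    rw [trace_pauliOp, trace_pauliOp, Complex.ofReal_re, Complex.ofReal_re] at h
    obtain ⟨rfl, rfl⟩ := hle (by linarith) (isDualFeasible_pauliOp.1 hK)
    rfl
  · rintro rfl
    refine ⟨hfeas, fun K' hK' => ?_⟩
    obtain ⟨k', c', rfl⟩ := hK'.exists_pauliOp
    rw [trace_pauliOp, trace_pauliOp, Complex.ofReal_re, Complex.ofReal_re]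
    rcases le_total k k' with h | h
    · linarith
    · rw [(hle h (isDualFeasible_pauliOp.1 hK')).1]

theorem isDensity_blochState {x : Vec} (hx : ‖x‖ ≤ 1) : IsDensity (blochState x) := by
  refine ⟨?_, ?_⟩
  · rw [blochState_eq, posSemidef_pauliOp, norm_smul, Real.norm_of_nonneg (by norm_num)]
    linarith
  · rw [blochState_eq, trace_pauliOp]
    norm_num

theorem norm_wOf_le (c : Vec) (i : Fin N) : ‖wOf q v c i‖ ≤ 1 := by
  rw [wOf, norm_sub_rev, norm_smul, norm_inv, norm_norm, norm_sub_rev]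
  exact inv_mul_le_one

theorem add_rOf_smul_complOf {c : Vec} {k : ℝ} {i : Fin N} (hr : 0 < ‖sPoint q v i - c‖)
    (hk : q i + ‖sPoint q v i - c‖ = k) :
    q i • blochState (v i) + rOf q v c i • complOf q v c i =
      pauliOp (k / 2) ((1 / 2 : ℝ) • (c + q 0 • v 0)) := by
  rw [complOf, blochState_eq, blochState_eq, pauliOp_smul, pauliOp_smul, pauliOp_add, pauliOp_inj]
  refine ⟨by rw [rOf]; linarith, ?_⟩
  rw [rOf, wOf, smul_comm _ (1 / 2 : ℝ) (_ • _), smul_inv_smul₀ hr.ne', sPoint]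
  module

theorem isComplementary_iff (hN : 2 ≤ N) (hD : affineDim (Set.range (sPoint q v)) = N - 1)
    {c : Vec} {k : ℝ} {t : Fin N → ℝ} (ht : IsBarycentric q v c t)
    (hk : ∀ i, q i + ‖sPoint q v i - c‖ = k) (r : Fin N → ℝ) (τ : Fin N → Op) :
    IsComplementary q (fun i => blochState (v i)) r τ ↔ r = rOf q v c ∧ τ = complOf q v c := by
  have hr := norm_sPoint_sub_pos hN hD ht
  have hdens : ∀ i, IsDensity (complOf q v c i) := fun i => isDensity_blochState (norm_wOf_le c i)
  constructor
  · rintro ⟨-, hτ, K, hK, hopt⟩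
    rw [isDualOptimal_iff ht hk] at hopt
    -- Uniqueness of `K` fixes the products `r i τ i`; the trace then gives `r i`, and `r i > 0` can
    -- be cancelled.
    have h1 : ∀ i, r i • τ i = rOf q v c i • complOf q v c i := fun i => by
      have h := hK i
      rw [hopt, ← add_rOf_smul_complOf (hr i) (hk i)] at h
      exact (add_left_cancel h).symm
    have h2 : ∀ i, r i = rOf q v c i := fun i => by
      have h := congrArg Matrix.trace (h1 i)
      rw [Matrix.trace_smul, Matrix.trace_smul, (hτ i).2, (hdens i).2] at h
      simpa using h
    refine ⟨funext h2, funext fun i => ?_⟩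
    have h := h1 i
    rw [h2 i] at h
    exact smul_right_injective _ (hr i).ne' h
  · rintro ⟨rfl, rfl⟩
    exact ⟨fun i => norm_nonneg _, hdens, _, fun i => (add_rOf_smul_complOf (hr i) (hk i)).symm,
      (isDualOptimal_iff ht hk).2 rfl⟩

theorem trace_complOf_mul_povmOf {c : Vec} {i : Fin N} (hr : 0 < ‖sPoint q v i - c‖)
    (t : Fin N → ℝ) : (complOf q v c i * povmOf q v c t i).trace = 0 := by
  rw [complOf, blochState_eq, povmOf_eq, trace_pauliOp_mul, Complex.ofReal_eq_zero,
    real_inner_smul_left, real_inner_smul_right, wOf, uOf, ← neg_sub (sPoint q v i) c,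
    real_inner_smul_left, real_inner_smul_right, inner_neg_left, real_inner_self_eq_norm_sq]
  field_simp
  ring

end Uniqueness

end QubitMD

end

/-! ### Assembly of the theorem -/

theorem theorem1 (N : ℕ) [NeZero N] (hN : 2 ≤ N)
    (q : Fin N → ℝ) (ρ : Fin N → Op) (v : Fin N → Vec)
    (hq_nonneg : ∀ i, 0 ≤ q i) (hq_sum : ∑ i, q i = 1) (hq_max : ∀ i, q i ≤ q 0)
    (hρ : ∀ i, IsDensity (ρ i)) (hv : ∀ i, ρ i = blochState (v i))
    (hD : affineDim (Set.range (sPoint q v)) = N - 1) :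
    -- the intersection point of the hyperboloids is unique if it exists
    (∀ c c' : Vec, IsIntersectionPoint q v c → IsIntersectionPoint q v c' → c = c') ∧
    (¬ OptimizedWithFewer q ρ ↔ ∃ c : Vec, IsIntersectionPoint q v c ∧ c ∈ Omega q v) ∧
    (∀ c : Vec, IsIntersectionPoint q v c → c ∈ Omega q v →
      (∃! M : Fin N → Op, IsOptimal q ρ M) ∧
      guessProb q ρ = q 0 + ‖c‖ ∧
      (∃! t : Fin N → ℝ, IsBarycentric q v c t) ∧
      (∀ t : Fin N → ℝ, IsBarycentric q v c t →
        IsOptimal q ρ (povmOf q v c t) ∧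
        ∀ i, rOf q v c i * (complOf q v c i * povmOf q v c t i).trace = 0) ∧
      (∀ (r : Fin N → ℝ) (τ : Fin N → Op),
        IsComplementary q ρ r τ ↔ r = rOf q v c ∧ τ = complOf q v c)) := by
  obtain rfl : ρ = fun i => blochState (v i) := funext hv
  have hk : ∀ c : Vec, IsIntersectionPoint q v c →
      ∀ i, q i + ‖sPoint q v i - c‖ = q 0 + ‖c‖ := fun c hc i => by
    by_cases hi : i = 0
    · simp [hi, sPoint_zero]
    · exact mem_hyperboloid_iff.1 (hc.1 i hi)
  have hpos : ∀ c t, IsBarycentric q v c t → 0 < ∑ j, t j * ‖sPoint q v j - c‖ :=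
    fun c t ht => Finset.sum_pos
      (fun i _ => mul_pos (ht.1 i) (norm_sPoint_sub_pos hN hD ht i)) ⟨0, Finset.mem_univ 0⟩
  have hopt : ∀ c t, IsIntersectionPoint q v c → IsBarycentric q v c t →
      IsOptimal q (fun i => blochState (v i)) (povmOf q v c t) := fun c t hc ht =>
    isOptimal_povmOf (fun i => (ht.1 i).le) ht.2.1 ht.2.2 (hpos c t ht) (fun i => (hk c hc i).le)
      fun i _ => hk c hc i
  have hsuc : ∀ c t, IsIntersectionPoint q v c → IsBarycentric q v c t →
      successProb q (fun i => blochState (v i)) (povmOf q v c t) = q 0 + ‖c‖ := fun c t hc ht =>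
    successProb_povmOf ht.2.1 ht.2.2 (hpos c t ht) fun i _ => hk c hc i
  have huniq : ∀ c t, IsIntersectionPoint q v c → IsBarycentric q v c t →
      ∀ M, IsOptimal q (fun i => blochState (v i)) M → M = povmOf q v c t := fun c t hc ht M hM =>
    eq_povmOf_of_le_successProb hN hD ht (hk c hc) hM.1
      ((hsuc c t hc ht).symm.trans_le (hM.2 _ (hopt c t hc ht).1))
  refine ⟨fun c c' hc hc' => hc.unique hN hD hq_max hc', ⟨fun h =>
    exists_intersectionPoint_of_not_optimizedWithFewer hN hD h, ?_⟩, fun c hc hcΩ => ?_⟩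
  · rintro ⟨c, hc, hcΩ⟩ h
    obtain ⟨t, ht⟩ := (mem_Omega_iff hD).1 hcΩ
    obtain ⟨M, hM, j, hj⟩ := optimizedWithFewer_iff.1 h
    -- A zero element of the unique optimal measurement would force its weight `p j` to be zero, but
    -- `t j` and `‖s j - c‖` are both positive.
    rw [huniq c t hc ht M hM, povmOf_eq, ← pauliOp_zero] at hj
    have h0 := (pauliOp_inj.1 hj).1
    exact (div_pos (mul_pos (ht.1 j) (norm_sPoint_sub_pos hN hD ht j)) (hpos c t ht)).ne' h0
  · obtain ⟨t, ht⟩ := (mem_Omega_iff hD).1 hcΩ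
    refine ⟨⟨_, hopt c t hc ht, huniq c t hc ht⟩, ?_, ⟨t, ht, fun t' ht' => ?_⟩,
      fun t' ht' => ⟨hopt c t' hc ht', fun i => ?_⟩, isComplementary_iff hN hD ht (hk c hc)⟩
    · rw [guessProb_eq_of_isOptimal (hopt c t hc ht), hsuc c t hc ht]
    · exact eq_of_isBarycentric hD ht'.2.1 ht.2.1 (ht'.2.2.trans ht.2.2.symm)
    · rw [trace_complOf_mul_povmOf (norm_sPoint_sub_pos hN hD ht i), mul_zero]
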